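/- Let $\lambda^{-1}>1$ be a P.V. number, i.e. a real algebraic integer greater than $1$ all of whose other Galois conjugates have absolute value less than $1$. Let $m\ge 1$, let $p_1,\dots,p_m\ge 1$ be integers, let $b_1,\dots,b_m\in\mathbb{Q}$, and put $S_i(x)=\lambda^{p_i}x+b_i$ for $x\in\mathbb{R}$. The open set condition (OSC) holds for $\{S_i\}_{i=1}^m$ if there is a non-empty open set $U\subset\mathbb{R}$ with $\bigcup_{i}S_i(U)\subset U$ and $S_i(U)\cap S_j(U)=\varnothing$ for all $i\ne j$. Equip $\mathbb{Z}\times\mathbb{R}$ with the group law $(p,b)(p',b')=(p+p',\lambda^{p}b'+b)$, so that $(p,b)^{-1}=(-p,-\lambda^{-p}b)$, and for a finite word $\sigma=i_1\cdots i_k$ over $\{1,\dots,m\}$ let $(p_\sigma,b_\sigma)=(p_{i_1},b_{i_1})\cdots(p_{i_k},b_{i_k})$; thus $S_{i_1}\circ\cdots\circ S_{i_k}(x)=\lambda^{p_\sigma}x+b_\sigma$. Let $T=\max_i p_i$, $B=\{0,b_1,\dots,b_m\}$, $$\mathcal{C}=\Big\{x\in\mathbb{R}: |x|\le\frac{(1+\lambda^{-T+1})\max_i|b_i|}{1-\lambda},\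 \lambda^{-T+2}x=R(\lambda^{-1})\text{ for some polynomial }R\text{ with coefficients in }B-B\Big\},$$ $\Xi=\{n\in\mathbb{Z}:|n|\le T-1\}\times\mathcal{C}$ and $\Lambda=\Xi\cap\{(p_i,b_i)^{-1}(p_j,b_j): i\ne j\}$. Let $G$ be the directed graph with vertex set $\Xi$ in which there is an edge from $(p,b)$ to $(p',b')$ if and only if $(p',b')=(p_\beta,b_\beta)^{-1}(p,b)(p_\alpha,b_\alpha)$ for some words $\alpha,\beta$ with $1\le p_\alpha\le 2T-1$ and $1\le p_\beta\le 2T-1$. Then $G$ is finite, and the OSC fails for $\{S_i\}_{i=1}^m$ if and only if there is a finite directed path in $G$ that starts at a point of $\Lambda$ and ends at $(0,0)$. -/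

import Mathlib

open scoped Pointwise Polynomial

noncomputable section

namespace PVIFS

/-- A Pisot-Vijayaraghavan number: a real algebraic integer greater than `1` all of whose other
Galois conjugates (in `ℂ`) have absolute value less than `1`. -/
def IsPV (η : ℝ) : Prop :=
  IsIntegral ℤ η ∧ 1 < η ∧ ∀ z ∈ (minpoly ℚ η).aroots ℂ, z ≠ (η : ℂ) → ‖z‖ < 1

/-- The open set condition for a family of self-maps of the line. -/
def OpenSetCondition {ι : Type*} (S : ι → ℝ → ℝ) : Prop :=
  ∃ U : Set ℝ, IsOpen U ∧ U.Nonempty ∧ (⋃ i, S i '' U) ⊆ U ∧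
    ∀ i j, i ≠ j → S i '' U ∩ S j '' U = ∅

/-- The maps `S_i(x) = lam ^ p_i * x + b_i`. -/
def ifs {m : ℕ} (lam : ℝ) (p : Fin m → ℕ) (b : Fin m → ℚ) (i : Fin m) (x : ℝ) : ℝ :=
  lam ^ p i * x + (b i : ℝ)

/-- The group law on `ℤ × ℝ` that corresponds to the composition of the maps
`x ↦ lam ^ q * x + c`, where `(q, c) ∈ ℤ × ℝ`. -/
def mul (lam : ℝ) (u v : ℤ × ℝ) : ℤ × ℝ :=
  (u.1 + v.1, lam ^ u.1 * v.2 + u.2)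

/-- The inverse for this group law. -/
def inv (lam : ℝ) (u : ℤ × ℝ) : ℤ × ℝ :=
  (-u.1, -(lam ^ (-u.1) * u.2))

/-- The pair `(p_i, b_i)` of a letter `i`. -/
def letter {m : ℕ} (p : Fin m → ℕ) (b : Fin m → ℚ) (i : Fin m) : ℤ × ℝ :=
  ((p i : ℤ), (b i : ℝ))

/-- The pair `(p_σ, b_σ) = (p_{i₁}, b_{i₁}) ⋯ (p_{iₖ}, b_{iₖ})` of a word `σ = i₁ ⋯ iₖ`;
it satisfies `S_{i₁} ∘ ⋯ ∘ S_{iₖ} = (x ↦ lam ^ p_σ * x + b_σ)`. -/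
def word {m : ℕ} (lam : ℝ) (p : Fin m → ℕ) (b : Fin m → ℚ) : List (Fin m) → ℤ × ℝ
  | [] => (0, 0)
  | i :: σ => mul lam (letter p b i) (word lam p b σ)

/-- `T = max_i p_i`. -/
def maxExp {m : ℕ} (p : Fin m → ℕ) : ℕ := Finset.univ.sup p

/-- `max_i |b_i|` (a maximum over a finite index set). -/
def maxAbs {m : ℕ} (b : Fin m → ℚ) : ℝ := ⨆ i, |(b i : ℝ)|

/-- `B = {0} ∪ {b_1, …, b_m}`. -/
def digits {m : ℕ} (b : Fin m → ℚ) : Set ℚ := {0} ∪ Set.range b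

/-- The set `𝒞` of all real `x` with `|x| ≤ (1 + lam ^ (-T + 1)) * max_i |b_i| / (1 - lam)` and
`lam ^ (-T + 2) * x = R(lam⁻¹)` for some polynomial `R` with coefficients in `B - B`. -/
def coordSet {m : ℕ} (lam : ℝ) (p : Fin m → ℕ) (b : Fin m → ℚ) : Set ℝ :=
  {x | |x| ≤ (1 + lam ^ (-(maxExp p : ℤ) + 1)) * maxAbs b / (1 - lam) ∧
    ∃ R : ℚ[X], (∀ n, R.coeff n ∈ digits b - digits b) ∧
      lam ^ (-(maxExp p : ℤ) + 2) * x = Polynomial.aeval lam⁻¹ R}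

/-- The vertex set `Ξ = {n ∈ ℤ : |n| ≤ T - 1} × 𝒞`. -/
def vertexSet {m : ℕ} (lam : ℝ) (p : Fin m → ℕ) (b : Fin m → ℚ) : Set (ℤ × ℝ) :=
  {n : ℤ | |n| ≤ (maxExp p : ℤ) - 1} ×ˢ coordSet lam p b

/-- The directed graph `G` on `Ξ`: there is an edge from `u` to `v` iff
`v = (p_β, b_β)⁻¹ u (p_α, b_α)` for some words `α`, `β` with `1 ≤ p_α, p_β ≤ 2 T - 1`
(these are nonempty, as the empty word has exponent `0`). -/
def graph {m : ℕ} (lam : ℝ) (p : Fin m → ℕ) (b : Fin m → ℚ) : Digraph (vertexSet lam p b) where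
  Adj u v := ∃ α β : List (Fin m),
    (1 ≤ (word lam p b α).1 ∧ (word lam p b α).1 ≤ 2 * (maxExp p : ℤ) - 1) ∧
    (1 ≤ (word lam p b β).1 ∧ (word lam p b β).1 ≤ 2 * (maxExp p : ℤ) - 1) ∧
    (v : ℤ × ℝ) = mul lam (mul lam (inv lam (word lam p b β)) u) (word lam p b α)

/-- `Λ = Ξ ∩ {(p_i, b_i)⁻¹ (p_j, b_j) : i ≠ j}`. -/
def startSet {m : ℕ} (lam : ℝ) (p : Fin m → ℕ) (b : Fin m → ℚ) : Set (ℤ × ℝ) :=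
  vertexSet lam p b ∩
    {u | ∃ i j : Fin m, i ≠ j ∧ u = mul lam (inv lam (letter p b i)) (letter p b j)}

end PVIFS

end

/-!
The open set condition fails exactly when there is an *exact overlap*: two words `i :: σ` and
`j :: τ` with `i ≠ j` whose maps coincide. Exact overlaps are in turn the same thing as paths in the
graph, because a vertex on a path is the relative position `S_σ⁻¹ S_τ` of two prefixes, an edge
appends a block to each of them, and `(0, 0)` is reached when the two maps agree.

*Finiteness.* If `R` has coefficients in a fixed finite set of rationals, then the conjugates of
`R(η)` at the conjugates of `η = lam⁻¹` other than `η` are bounded by a geometric series, since `η`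
is a P.V. number. So only finitely many such `R(η)` lie in a bounded interval
(`finite_setOf_abs_le_eq_aeval`). Relative positions of words of comparable contraction ratio have
this form (`exists_quotient_snd_eq`).

*An exact overlap gives a path.* The two words are cut into blocks so that the exponents of the
prefixes differ by at most `T - 1`; the translation part of a relative position is bounded because
it is also `S_σ' S_τ'⁻¹` for the remaining suffixes (`mem_vertexSet_of_word_eq`,
`exists_path_of_word_eq`).

*Without exact overlaps the open set condition holds.* Let `J` be an open interval mapped into
itself by every `S_i`. The neighbours of a word `σ` are the words `τ` of comparable contraction
ratio such that `S_τ(J)` meets `S_σ(J)`. Their relative positions to `σ` lie in one finite set and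
determine `τ`, so the number of neighbours is bounded. For a word `ω` with the maximal number of
neighbours, the neighbours of `ρω` are exactly the words `ρτ` with `τ` a neighbour of `ω`
(`exists_neighbors_append_eq`). It follows that `S_{ρω}(J)` and `S_{ρ'ω}(J)` are disjoint whenever
`ρ` and `ρ'` begin with different letters, and the union of all `S_{ρω}(J)` is the open set required
(`openSetCondition_of_not_hasExactOverlap`).
-/

open scoped Pointwise Polynomial

noncomputable section

namespace PVIFS

/-! ### Polynomials with finitely many coefficients at a P.V. number -/

/-- Only finitely many values of polynomials with coefficients in a fixed finite set lie in a
bounded interval: after clearing denominators they are algebraic integers of `ℚ(η)` all of whose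
conjugates are bounded. -/
theorem finite_setOf_abs_le_eq_aeval {η : ℝ} (hη : IsPV η) {D : Set ℚ} (hD : D.Finite) (K : ℝ) :
    {y : ℝ | |y| ≤ K ∧ ∃ R : ℚ[X], (∀ n, R.coeff n ∈ D) ∧ y = Polynomial.aeval η R}.Finite := by
  obtain ⟨hint, -, hconj⟩ := hη
  obtain ⟨⟨d, hd⟩, hdD⟩ :=
    IsLocalization.exist_integer_multiples_of_finset (nonZeroDivisors ℤ) hD.toFinset
  have hd0 : d ≠ 0 := nonZeroDivisors.ne_zero hd
  obtain ⟨M, hM⟩ : ∃ M : ℝ, ∀ q ∈ D, |(q : ℝ)| ≤ M := by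
    obtain ⟨M, hM⟩ := (hD.image fun q : ℚ => |(q : ℝ)|).bddAbove
    exact ⟨M, fun q hq => hM ⟨q, hq, rfl⟩⟩
  let L := IntermediateField.adjoin ℚ {η}
  let θ : L := IntermediateField.AdjoinSimple.gen ℚ η
  have hθ : (θ : ℝ) = η := IntermediateField.AdjoinSimple.coe_gen ℚ η
  have hintQ : IsIntegral ℚ η := hint.tower_top
  have : FiniteDimensional ℚ L := IntermediateField.adjoin.finiteDimensional hintQ
  have : NumberField L := { to_charZero := inferInstance, to_finiteDimensional := this }
  have hθint : IsIntegral ℤ θ := by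
    rw [← isIntegral_algebraMap_iff (B := ℝ) (algebraMap L ℝ).injective]
    exact hint
  -- A bound for all conjugates of `d * R(θ)`: the first term serves the embeddings with `φ θ = η`,
  -- the sum all others. The absolute values only keep every term nonnegative.
  let C : ℝ := |(d : ℝ)| * |K| + ∑ φ : L →+* ℂ, |(d : ℝ)| * |M| * |(1 - ‖φ θ‖)⁻¹|
  have hsum : 0 ≤ ∑ φ : L →+* ℂ, |(d : ℝ)| * |M| * |(1 - ‖φ θ‖)⁻¹| :=
    Finset.sum_nonneg fun _ _ => by positivity
  refine ((NumberField.Embeddings.finite_of_norm_le L ℂ C).image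
    fun x : L => (x : ℝ) / d).subset ?_
  rintro y ⟨hyK, R, hR, rfl⟩
  have hcoe : ((Polynomial.aeval θ R : L) : ℝ) = Polynomial.aeval η R := by
    rw [← hθ]
    exact (Polynomial.aeval_algebraMap_apply ℝ θ R).symm
  refine ⟨(d : L) * Polynomial.aeval θ R, ⟨?_, fun φ => ?_⟩, ?_⟩
  · rw [Polynomial.aeval_eq_sum_range, Finset.mul_sum]
    refine IsIntegral.sum _ fun n _ => ?_
    obtain ⟨z, hz⟩ := hdD (R.coeff n) (hD.mem_toFinset.2 (hR n))
    have : (d : L) * (R.coeff n • θ ^ n) = (z : L) * θ ^ n := by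
      have hz' : (z : ℚ) = d * R.coeff n := by simpa using hz
      rw [Algebra.smul_def, ← mul_assoc]
      congr 1
      have := congrArg (algebraMap ℚ L) hz'
      simpa using this.symm
    rw [this]
    exact (isIntegral_algebraMap (x := z)).mul (hθint.pow n)
  · by_cases hφ : φ θ = (η : ℂ)
    · have : φ (Polynomial.aeval θ R) = ((Polynomial.aeval η R : ℝ) : ℂ) := by
        have h1 := Polynomial.hom_eval₂ R (algebraMap ℚ L) φ θ
        have h2 := Polynomial.hom_eval₂ R (algebraMap ℚ ℝ) Complex.ofRealHom η
        rw [hφ] at h1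
        rw [Polynomial.aeval_def, Polynomial.aeval_def, h1]
        refine Eq.trans ?_ h2.symm
        congr 1
        exact Subsingleton.elim _ _
      rw [map_mul, this, norm_mul, map_intCast, Complex.norm_real, Complex.norm_intCast,
        Real.norm_eq_abs]
      have : |(d : ℝ)| * |Polynomial.aeval η R| ≤ |(d : ℝ)| * |K| :=
        mul_le_mul_of_nonneg_left (hyK.trans (le_abs_self K)) (abs_nonneg _)
      linarith
    · have hroot : φ θ ∈ (minpoly ℚ η).aroots ℂ := by
        rw [Polynomial.mem_aroots]
        refine ⟨minpoly.ne_zero hintQ, ?_⟩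
        have h1 : Polynomial.aeval θ (minpoly ℚ η) = 0 := by
          rw [← IntermediateField.minpoly_gen ℚ η]
          exact minpoly.aeval _ _
        have h2 := Polynomial.aeval_algHom_apply φ.toRatAlgHom θ (minpoly ℚ η)
        rw [h1, map_zero] at h2
        exact h2
      have hlt : ‖φ θ‖ < 1 := hconj _ hroot hφ
      have hb : ‖φ (Polynomial.aeval θ R)‖ ≤ |M| * |(1 - ‖φ θ‖)⁻¹| := by
        rw [Polynomial.aeval_eq_sum_range, map_sum]
        calc ‖∑ n ∈ Finset.range (R.natDegree + 1), φ (R.coeff n • θ ^ n)‖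
            ≤ ∑ n ∈ Finset.range (R.natDegree + 1), |M| * ‖φ θ‖ ^ n := by
              refine norm_sum_le_of_le _ fun n _ => ?_
              rw [Algebra.smul_def, map_mul, map_pow, norm_mul, norm_pow]
              gcongr
              have : φ (algebraMap ℚ L (R.coeff n)) = ((R.coeff n : ℝ) : ℂ) := by simp
              rw [this, Complex.norm_real]
              exact (hM _ (hR n)).trans (le_abs_self M)
          _ = |M| * ∑ n ∈ Finset.range (R.natDegree + 1), ‖φ θ‖ ^ n := by rw [Finset.mul_sum]
          _ ≤ |M| * |(1 - ‖φ θ‖)⁻¹| := by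
              gcongr
              refine le_trans ?_ (le_abs_self _)
              rw [← tsum_geometric_of_lt_one (norm_nonneg _) hlt]
              exact (summable_geometric_of_lt_one (norm_nonneg _) hlt).sum_le_tsum _
                fun _ _ => by positivity
      have hs := Finset.single_le_sum (f := fun φ : L →+* ℂ =>
        |(d : ℝ)| * |M| * |(1 - ‖φ θ‖)⁻¹|) (fun _ _ => by positivity) (Finset.mem_univ φ)
      rw [map_mul, norm_mul, map_intCast, Complex.norm_intCast]
      have : |(d : ℝ)| * ‖φ (Polynomial.aeval θ R)‖ ≤ |(d : ℝ)| * (|M| * |(1 - ‖φ θ‖)⁻¹|) := by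
        gcongr
      have h0 : 0 ≤ |(d : ℝ)| * |K| := by positivity
      simp only [C]
      linarith
  · have : (d : ℝ) ≠ 0 := by exact_mod_cast hd0
    have h2 : (((d : L) * Polynomial.aeval θ R : L) : ℝ) = d * Polynomial.aeval η R := by
      rw [← hcoe]; simp
    simp only [h2]
    field_simp

/-! ### Words and their exponents -/

section Words

variable {m : ℕ} {lam : ℝ} {p : Fin m → ℕ} {b : Fin m → ℚ}

theorem mul_assoc' (h0 : lam ≠ 0) (u v w : ℤ × ℝ) :
    mul lam (mul lam u v) w = mul lam u (mul lam v w) := by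
  ext
  · simp [mul, add_assoc]
  · simp only [mul, zpow_add₀ h0]
    ring

theorem mul_inv_self (h0 : lam ≠ 0) (u : ℤ × ℝ) : mul lam u (inv lam u) = (0, 0) := by
  ext
  · simp [mul, inv]
  · have := zpow_ne_zero u.1 h0
    simp only [mul, inv, zpow_neg]
    field_simp
    ring

theorem inv_mul_self (u : ℤ × ℝ) : mul lam (inv lam u) u = (0, 0) := by
  ext <;> simp [mul, inv]

theorem zero_mul' (u : ℤ × ℝ) : mul lam (0, 0) u = u := by
  ext <;> simp [mul]

theorem mul_left_cancel' (h0 : lam ≠ 0) {u v w : ℤ × ℝ} (h : mul lam u v = mul lam u w) :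
    v = w := by
  have := congrArg (mul lam (inv lam u)) h
  rwa [← mul_assoc' h0, ← mul_assoc' h0, inv_mul_self, zero_mul', zero_mul'] at this

theorem eq_of_inv_mul_eq_zero (h0 : lam ≠ 0) {u v : ℤ × ℝ} (h : mul lam (inv lam u) v = (0, 0)) :
    v = u := by
  rw [← inv_mul_self (lam := lam) u] at h
  exact mul_left_cancel' h0 h

theorem inv_mul_mul_eq (h0 : lam ≠ 0) (u v a c : ℤ × ℝ) :
    mul lam (inv lam (mul lam v c)) (mul lam u a) =
      mul lam (mul lam (inv lam c) (mul lam (inv lam v) u)) a := by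
  apply mul_left_cancel' h0 (u := mul lam v c)
  rw [← mul_assoc' h0, mul_inv_self h0, zero_mul', mul_assoc' h0 _ _ a, mul_assoc' h0 v,
    ← mul_assoc' h0 c, mul_inv_self h0, zero_mul', ← mul_assoc' h0 v, ← mul_assoc' h0 v,
    mul_inv_self h0, zero_mul']

/-- The similarity `x ↦ lam ^ q * x + c` that corresponds to `(q, c)`. -/
def act (lam : ℝ) (u : ℤ × ℝ) (x : ℝ) : ℝ := lam ^ u.1 * x + u.2

theorem act_mul (h0 : lam ≠ 0) (u v : ℤ × ℝ) (x : ℝ) :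
    act lam (mul lam u v) x = act lam u (act lam v x) := by
  simp only [act, mul, zpow_add₀ h0]
  ring

theorem act_letter (i : Fin m) (x : ℝ) : act lam (letter p b i) x = ifs lam p b i x := by
  simp [act, letter, ifs]

theorem word_append (h0 : lam ≠ 0) (σ τ : List (Fin m)) :
    word lam p b (σ ++ τ) = mul lam (word lam p b σ) (word lam p b τ) := by
  induction σ with
  | nil => simp [word, zero_mul']
  | cons i σ ih => simp [word, ih, mul_assoc' h0]

theorem word_singleton (i : Fin m) : word lam p b [i] = letter p b i := by
  ext <;> simp [word, mul]

/-- The exponent `p_σ` of a word, as a natural number. -/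
def expo (p : Fin m → ℕ) (σ : List (Fin m)) : ℕ := (σ.map p).sum

@[simp] theorem expo_nil : expo p [] = 0 := rfl

@[simp] theorem expo_cons (i : Fin m) (σ : List (Fin m)) :
    expo p (i :: σ) = p i + expo p σ := by simp [expo]

@[simp] theorem expo_append (σ τ : List (Fin m)) :
    expo p (σ ++ τ) = expo p σ + expo p τ := by simp [expo]

theorem word_fst (σ : List (Fin m)) : (word lam p b σ).1 = expo p σ := by
  induction σ with
  | nil => rfl
  | cons i σ ih => simp [word, mul, letter, ih]

theorem word_cons_snd (i : Fin m) (σ : List (Fin m)) :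
    (word lam p b (i :: σ)).2 = lam ^ p i * (word lam p b σ).2 + b i := by
  simp [word, mul, letter]

theorem expo_eq_zero (hp : ∀ i, 1 ≤ p i) {σ : List (Fin m)} (h : expo p σ = 0) : σ = [] := by
  cases σ with
  | nil => rfl
  | cons i σ => have := hp i; simp at h; omega

theorem one_le_expo (hp : ∀ i, 1 ≤ p i) {σ : List (Fin m)} (h : σ ≠ []) : 1 ≤ expo p σ := by
  by_contra! h'
  exact h (expo_eq_zero hp (by omega))

theorem le_maxExp (i : Fin m) : p i ≤ maxExp p := Finset.le_sup (f := p) (Finset.mem_univ i)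

theorem abs_le_maxAbs (i : Fin m) : |(b i : ℝ)| ≤ maxAbs b :=
  le_ciSup (f := fun i => |(b i : ℝ)|) (Set.finite_range _).bddAbove i

theorem maxAbs_nonneg : 0 ≤ maxAbs b := Real.iSup_nonneg fun _ => abs_nonneg _

/-- In particular every `S_i` maps `[-M, M]` into itself as soon as `maxAbs b ≤ (1 - lam) * M`. -/
theorem abs_ifs_le (h0 : 0 < lam) (h1 : lam < 1) (hp : ∀ i, 1 ≤ p i) (i : Fin m) (x : ℝ) :
    |ifs lam p b i x| ≤ lam * |x| + maxAbs b := by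
  refine (abs_add_le _ _).trans (add_le_add ?_ (abs_le_maxAbs i))
  rw [abs_mul, abs_of_pos (pow_pos h0 _)]
  gcongr
  simpa using pow_le_pow_of_le_one h0.le h1.le (hp i)

theorem abs_word_snd_le (h0 : 0 < lam) (h1 : lam < 1) (hp : ∀ i, 1 ≤ p i) (σ : List (Fin m)) :
    |(word lam p b σ).2| ≤ maxAbs b / (1 - lam) := by
  have h2 : 0 < 1 - lam := by linarith
  induction σ with
  | nil =>
    have : 0 ≤ maxAbs b := maxAbs_nonneg
    simp only [word, abs_zero]; positivity
  | cons i σ ih =>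
    rw [word_cons_snd]
    have h3 : maxAbs b / (1 - lam) = lam * (maxAbs b / (1 - lam)) + maxAbs b := by
      field_simp; ring
    have h4 := abs_ifs_le (b := b) h0 h1 hp i (word lam p b σ).2
    rw [ifs] at h4
    nlinarith

/-! ### Translation parts as polynomials in `lam⁻¹` -/

theorem zero_mem_digits : (0 : ℚ) ∈ digits b := Or.inl rfl

/-- Writing `b_σ` as a sum of `lam ^ k * b_i` with distinct exponents `k < p_σ` and factoring out
`lam ^ N` leaves a polynomial in `lam⁻¹` with coefficients in `B`. -/
theorem exists_word_snd_eq (h0 : lam ≠ 0) (hp : ∀ i, 1 ≤ p i) (σ : List (Fin m)) (N : ℕ)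
    (hN : expo p σ ≤ N + 1) :
    ∃ R : ℚ[X], R.natDegree ≤ N ∧ (∀ n, R.coeff n ∈ digits b) ∧
      (word lam p b σ).2 = lam ^ N * Polynomial.aeval lam⁻¹ R := by
  induction σ generalizing N with
  | nil => exact ⟨0, by simp, fun n => by simpa using zero_mem_digits, by simp [word]⟩
  | cons i σ ih =>
    have hi := hp i
    simp only [expo_cons] at hN
    obtain ⟨R, hdeg, hcoeff, hR⟩ : ∃ R : ℚ[X], (∀ n, N ≤ n → R.coeff n = 0) ∧
        (∀ n, R.coeff n ∈ digits b) ∧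
        lam ^ p i * (word lam p b σ).2 = lam ^ N * Polynomial.aeval lam⁻¹ R := by
      by_cases h : p i ≤ N
      · obtain ⟨R, hdeg, hcoeff, hR⟩ := ih (N - p i) (by omega)
        refine ⟨R, fun n hn => Polynomial.coeff_eq_zero_of_natDegree_lt (by omega), hcoeff, ?_⟩
        rw [hR, ← mul_assoc, ← pow_add]
        congr 2
        omega
      · have : σ = [] := expo_eq_zero hp (by omega)
        subst this
        exact ⟨0, by simp, fun n => by simpa using zero_mem_digits, by simp [word]⟩
    refine ⟨R + Polynomial.monomial N (b i), ?_, fun n => ?_, ?_⟩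
    · rw [Polynomial.natDegree_le_iff_coeff_eq_zero]
      intro n hn
      rw [Polynomial.coeff_add, hdeg n hn.le, Polynomial.coeff_monomial, if_neg (by omega),
        add_zero]
    · rw [Polynomial.coeff_add, Polynomial.coeff_monomial]
      split_ifs with h
      · rw [hdeg n h.le, zero_add]
        exact Or.inr ⟨i, rfl⟩
      · rw [add_zero]
        exact hcoeff n
    · rw [word_cons_snd, hR, map_add, Polynomial.aeval_monomial, mul_add]
      have : lam ^ N ≠ 0 := pow_ne_zero _ h0
      simp only [inv_pow, eq_ratCast]
      field_simp

/-- The polynomial condition in `coordSet` holds for the relative position `S_σ⁻¹ S_τ` of words with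
`p_τ - p_σ ≤ T - 1`. The word `σ` has to be nonempty, as otherwise `p_σ + T - 2` may be negative. -/
theorem exists_quotient_snd_eq (h0 : lam ≠ 0) (hp : ∀ i, 1 ≤ p i) {σ τ : List (Fin m)}
    (hσ : σ ≠ []) (hτ : expo p τ + 1 ≤ expo p σ + maxExp p) :
    ∃ R : ℚ[X], (∀ n, R.coeff n ∈ digits b - digits b) ∧
      lam ^ (-(maxExp p : ℤ) + 2) * (mul lam (inv lam (word lam p b σ)) (word lam p b τ)).2 =
        Polynomial.aeval lam⁻¹ R := by
  have h1 := one_le_expo hp hσ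
  have hT : 1 ≤ maxExp p := by
    obtain ⟨i, σ', rfl⟩ := List.exists_cons_of_ne_nil hσ
    exact (hp i).trans (le_maxExp i)
  obtain ⟨N, hN⟩ : ∃ N, N + 2 = expo p σ + maxExp p := ⟨expo p σ + maxExp p - 2, by omega⟩
  obtain ⟨R, -, hR, hRe⟩ := exists_word_snd_eq (b := b) h0 hp τ N (by omega)
  obtain ⟨Q, -, hQ, hQe⟩ := exists_word_snd_eq (b := b) h0 hp σ N (by omega)
  refine ⟨R - Q, fun n => ?_, ?_⟩
  · rw [Polynomial.coeff_sub]
    exact Set.sub_mem_sub (hR n) (hQ n)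
  · have e : lam ^ (-(maxExp p : ℤ) + 2) * lam ^ (-(expo p σ : ℤ)) = (lam ^ N)⁻¹ := by
      rw [← zpow_add₀ h0, ← zpow_natCast, ← zpow_neg]
      congr 1
      omega
    have hne : lam ^ N ≠ 0 := pow_ne_zero _ h0
    simp only [mul, inv, word_fst]
    rw [hRe, hQe, map_sub]
    calc _ = (lam ^ (-(maxExp p : ℤ) + 2) * lam ^ (-(expo p σ : ℤ))) * (lam ^ N *
          (Polynomial.aeval lam⁻¹ R - Polynomial.aeval lam⁻¹ Q)) := by ring
      _ = _ := by rw [e]; field_simp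

/-! ### Exact overlaps and cuts of words -/

/-- `S_σ` and `S_τ` coincide for some words `σ`, `τ` with different first letters. -/
def HasExactOverlap (lam : ℝ) (p : Fin m → ℕ) (b : Fin m → ℚ) : Prop :=
  ∃ i j : Fin m, i ≠ j ∧ ∃ σ τ : List (Fin m),
    word lam p b (i :: σ) = word lam p b (j :: τ)

theorem word_injective (h0 : lam ≠ 0) (hp : ∀ i, 1 ≤ p i) (h : ¬ HasExactOverlap lam p b) :
    Function.Injective (word lam p b) := by
  intro σ τ hst
  induction σ generalizing τ with
  | nil =>
    have := congrArg Prod.fst hst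
    rw [word_fst, word_fst] at this
    exact (expo_eq_zero hp (by simpa using this.symm)).symm
  | cons i σ ih =>
    cases τ with
    | nil =>
      have := congrArg Prod.fst hst
      rw [word_fst, word_fst] at this
      exact expo_eq_zero hp (by exact_mod_cast this)
    | cons j τ =>
      by_cases hij : i = j
      · subst hij
        rw [ih (mul_left_cancel' h0 hst)]
      · exact absurd ⟨i, j, hij, σ, τ, hst⟩ h

/-- The words `σ` whose exponent reaches `t` with the last letter: for `t ≥ 1`, every word of
exponent at least `t` has exactly one prefix in this set. -/
def cut (p : Fin m → ℕ) (t : ℕ) : Set (List (Fin m)) :=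
  {σ | σ ≠ [] ∧ t ≤ expo p σ ∧ expo p σ.dropLast < t}

theorem expo_lt_of_mem_cut {t : ℕ} {σ : List (Fin m)} (h : σ ∈ cut p t) :
    expo p σ < t + maxExp p := by
  obtain ⟨hne, -, h2⟩ := h
  have := le_maxExp (p := p) (σ.getLast hne)
  have h3 := congrArg (expo p) (List.dropLast_append_getLast hne)
  simp at h3
  omega

theorem append_mem_cut {t : ℕ} {σ : List (Fin m)} (h : σ ∈ cut p t) (τ : List (Fin m)) :
    τ ++ σ ∈ cut p (expo p τ + t) := by
  obtain ⟨h1, h2, h3⟩ := h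
  refine ⟨by simp [h1], by simpa using h2, ?_⟩
  rw [List.dropLast_append_of_ne_nil h1, expo_append]
  omega

theorem exists_prefix_mem_cut {t : ℕ} (ht : 1 ≤ t) (σ : List (Fin m)) (h : t ≤ expo p σ) :
    ∃ σ₁ σ₂, σ₁ ++ σ₂ = σ ∧ σ₁ ∈ cut p t := by
  induction σ using List.reverseRecOn with
  | nil => simp at h; omega
  | append_singleton σ i ih =>
    by_cases h' : t ≤ expo p σ
    · obtain ⟨σ₁, σ₂, rfl, h₁⟩ := ih h'
      exact ⟨σ₁, σ₂ ++ [i], by simp, h₁⟩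
    · exact ⟨σ ++ [i], [], by simp, by simp, h, by simpa using h'⟩

end Words

/-! ### Vertices, paths and exact overlaps -/

section Graph

variable {m : ℕ} {lam : ℝ} {p : Fin m → ℕ} {b : Fin m → ℚ}

theorem IsPV.pos_lt_one (hlam : IsPV lam⁻¹) : 0 < lam ∧ lam < 1 :=
  one_lt_inv_iff₀.1 hlam.2.1

/-- The finiteness of `coordSet`, with an arbitrary bound on `|x|`. -/
theorem finite_coord_of_bound (hlam : IsPV lam⁻¹) (p : Fin m → ℕ) (b : Fin m → ℚ) (K : ℝ) :
    {x : ℝ | |x| ≤ K ∧ ∃ R : ℚ[X], (∀ n, R.coeff n ∈ digits b - digits b) ∧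
      lam ^ (-(maxExp p : ℤ) + 2) * x = Polynomial.aeval lam⁻¹ R}.Finite := by
  have h0 := hlam.pos_lt_one.1
  have hfin : (digits b - digits b).Finite := by
    have : (digits b).Finite := (Set.finite_singleton _).union (Set.finite_range b)
    exact this.sub this
  have hc : 0 < lam ^ (-(maxExp p : ℤ) + 2) := zpow_pos h0 _
  refine Set.Finite.of_injOn (f := fun x => lam ^ (-(maxExp p : ℤ) + 2) * x) ?_
    (mul_right_injective₀ hc.ne').injOn
    (finite_setOf_abs_le_eq_aeval hlam hfin (lam ^ (-(maxExp p : ℤ) + 2) * K))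
  rintro x ⟨hx, R, hR, hRx⟩
  refine ⟨?_, R, hR, hRx⟩
  rw [abs_mul, abs_of_pos hc]
  gcongr

theorem finite_vertexSet (hlam : IsPV lam⁻¹) (p : Fin m → ℕ) (b : Fin m → ℚ) :
    (vertexSet lam p b).Finite := by
  refine Set.Finite.prod ?_ (finite_coord_of_bound hlam p b _)
  exact (Set.finite_Icc (-((maxExp p : ℤ) - 1)) ((maxExp p : ℤ) - 1)).subset
    fun n hn => abs_le.1 hn

/-- A path to `(0, 0)` extends the two words of its starting point to words with the same map. -/
theorem exists_word_eq_of_path (h0 : lam ≠ 0) {x y : vertexSet lam p b}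
    (h : Relation.ReflTransGen (graph lam p b).Adj x y) (hy : (y : ℤ × ℝ) = (0, 0))
    (σ τ : List (Fin m))
    (hx : (x : ℤ × ℝ) = mul lam (inv lam (word lam p b σ)) (word lam p b τ)) :
    ∃ σ' τ', word lam p b (σ ++ σ') = word lam p b (τ ++ τ') := by
  induction h using Relation.ReflTransGen.head_induction_on generalizing σ τ with
  | refl =>
    refine ⟨[], [], ?_⟩
    rw [List.append_nil, List.append_nil]
    exact (eq_of_inv_mul_eq_zero h0 (hx.symm.trans hy)).symm
  | head h _ ih =>
    obtain ⟨α, β, -, -, hv⟩ := h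
    obtain ⟨σ', τ', h'⟩ := ih (σ ++ β) (τ ++ α) (by
      rw [hv, hx, word_append h0, word_append h0, inv_mul_mul_eq h0])
    exact ⟨β ++ σ', α ++ τ', by simpa using h'⟩

theorem word_mapsTo (h0 : lam ≠ 0) {U : Set ℝ} (hU : (⋃ i, ifs lam p b i '' U) ⊆ U)
    (σ : List (Fin m)) {x : ℝ} (hx : x ∈ U) : act lam (word lam p b σ) x ∈ U := by
  induction σ with
  | nil => simpa [word, act] using hx
  | cons i σ ih =>
    rw [word, act_mul h0, act_letter]
    exact hU (Set.mem_iUnion.2 ⟨i, _, ih, rfl⟩)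

theorem HasExactOverlap.not_openSetCondition (h0 : lam ≠ 0) (h : HasExactOverlap lam p b) :
    ¬ OpenSetCondition (ifs lam p b) := by
  rintro ⟨U, -, ⟨x, hx⟩, hsub, hdisj⟩
  obtain ⟨i, j, hij, σ, τ, hστ⟩ := h
  have key : ∀ i σ, act lam (word lam p b (i :: σ)) x ∈ ifs lam p b i '' U := fun i σ => by
    rw [word, act_mul h0, act_letter]
    exact ⟨_, word_mapsTo h0 hsub σ hx, rfl⟩
  have : act lam (word lam p b (i :: σ)) x ∈ ifs lam p b i '' U ∩ ifs lam p b j '' U :=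
    ⟨key i σ, hστ ▸ key j τ⟩
  rw [hdisj i j hij] at this
  exact this

/-- Two nearly equally long prefixes of words with the same map have a vertex as their relative
position. -/
theorem mem_vertexSet_of_word_eq (h0 : 0 < lam) (h1 : lam < 1) (hp : ∀ i, 1 ≤ p i)
    {σ τ σ' τ' : List (Fin m)} (hσ : σ ≠ []) (h₁ : expo p σ + 1 ≤ expo p τ + maxExp p)
    (h₂ : expo p τ + 1 ≤ expo p σ + maxExp p)
    (h : word lam p b (σ ++ σ') = word lam p b (τ ++ τ')) :
    mul lam (inv lam (word lam p b σ)) (word lam p b τ) ∈ vertexSet lam p b := by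
  refine ⟨?_, ?_, exists_quotient_snd_eq h0.ne' hp hσ h₂⟩
  · simp only [mul, inv, word_fst, Set.mem_ofPred_eq, abs_le]
    omega
  · -- Cancelling the common map gives `S_σ⁻¹ S_τ = S_σ' S_τ'⁻¹`, whose translation part is bounded.
    have e1 := congrArg Prod.fst h
    rw [word_fst, word_fst, expo_append, expo_append] at e1
    have e : (mul lam (inv lam (word lam p b σ)) (word lam p b τ)).2 =
        (word lam p b σ').2 - lam ^ ((expo p σ' : ℤ) - expo p τ') * (word lam p b τ').2 := by
      have e2 := congrArg Prod.snd h
      rw [word_append h0.ne', word_append h0.ne'] at e2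
      simp only [mul, inv, word_fst] at e2 ⊢
      have e3 : (expo p σ' : ℤ) - expo p τ' = -(expo p σ : ℤ) + expo p τ := by
        push_cast at e1; omega
      rw [e3, zpow_add₀ h0.ne', zpow_neg]
      have := (zpow_pos h0 (expo p σ : ℤ)).ne'
      field_simp
      linarith
    rw [e]
    have hB := abs_word_snd_le (b := b) h0 h1 hp
    have hpow : lam ^ ((expo p σ' : ℤ) - expo p τ') ≤ lam ^ (-(maxExp p : ℤ) + 1) :=
      zpow_le_zpow_right_of_le_one₀ h0 h1.le (by push_cast at e1; omega)
    have hpos := zpow_pos h0 ((expo p σ' : ℤ) - expo p τ')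
    calc _ ≤ |(word lam p b σ').2| +
          |lam ^ ((expo p σ' : ℤ) - expo p τ') * (word lam p b τ').2| := abs_sub _ _
      _ ≤ maxAbs b / (1 - lam) + lam ^ (-(maxExp p : ℤ) + 1) * (maxAbs b / (1 - lam)) := by
        rw [abs_mul, abs_of_pos hpos]
        exact add_le_add (hB _) (mul_le_mul hpow (hB _) (abs_nonneg _) (hpos.le.trans hpow))
      _ = _ := by ring

/-- If the maps of `σ ++ σ'` and `τ ++ τ'` coincide and `S_σ⁻¹ S_τ` is a vertex, then appending
blocks of `σ'` and `τ'` to `σ` and `τ` gives a path from this vertex to `(0, 0)`. -/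
theorem exists_path_of_word_eq (h0 : 0 < lam) (h1 : lam < 1) (hp : ∀ i, 1 ≤ p i) (c : Fin m)
    (σ τ σ' τ' : List (Fin m)) (hσ : σ ≠ []) (h₁ : expo p σ + 1 ≤ expo p τ + maxExp p)
    (h₂ : expo p τ + 1 ≤ expo p σ + maxExp p)
    (h : word lam p b (σ ++ σ') = word lam p b (τ ++ τ')) (x : vertexSet lam p b)
    (hx : (x : ℤ × ℝ) = mul lam (inv lam (word lam p b σ)) (word lam p b τ)) :
    ∃ y : vertexSet lam p b, (y : ℤ × ℝ) = (0, 0) ∧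
      Relation.ReflTransGen (graph lam p b).Adj x y := by
  induction hn : expo p σ' using Nat.strong_induction_on generalizing σ τ σ' τ' x with
  | _ n ih =>
  have hexp : expo p σ + expo p σ' = expo p τ + expo p τ' := by
    have e1 := congrArg Prod.fst h
    rw [word_fst, word_fst, expo_append, expo_append] at e1
    exact_mod_cast e1
  have hedge : ∀ (α β : List (Fin m)) (y : vertexSet lam p b),
      1 ≤ expo p α → expo p α + 1 ≤ 2 * maxExp p → 1 ≤ expo p β → expo p β + 1 ≤ 2 * maxExp p →
      (y : ℤ × ℝ) = mul lam (inv lam (word lam p b (σ ++ β))) (word lam p b (τ ++ α)) →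
      (graph lam p b).Adj x y := by
    intro α β y hα hα' hβ hβ' hy
    refine ⟨α, β, ?_, ?_, ?_⟩
    · rw [word_fst]; omega
    · rw [word_fst]; omega
    · rw [hy, hx, word_append h0.ne', word_append h0.ne', inv_mul_mul_eq h0.ne']
  by_cases hnil : σ' = [] ∨ τ' = []
  · -- One of the words is used up. A common letter appended to both makes the last blocks nonempty.
    have hc := hp c
    have hcT := le_maxExp (p := p) c
    have hmin : expo p σ' = 0 ∨ expo p τ' = 0 := by
      rcases hnil with rfl | rfl <;> simp
    have heq : word lam p b (σ ++ (σ' ++ [c])) = word lam p b (τ ++ (τ' ++ [c])) := by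
      rw [← List.append_assoc, ← List.append_assoc, word_append h0.ne', h, ← word_append h0.ne']
    have hz : mul lam (inv lam (word lam p b (σ ++ (σ' ++ [c]))))
        (word lam p b (τ ++ (τ' ++ [c]))) = (0, 0) := by rw [heq, inv_mul_self]
    have hmem := mem_vertexSet_of_word_eq (b := b) h0 h1 hp (σ := σ ++ (σ' ++ [c]))
      (τ := τ ++ (τ' ++ [c])) (σ' := []) (τ' := []) (by simp)
      (by simp; omega) (by simp; omega) (by simpa using heq)
    refine ⟨⟨_, hmem⟩, hz, .single (hedge (τ' ++ [c]) (σ' ++ [c]) _ ?_ ?_ ?_ ?_ rfl)⟩ <;>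
      simp <;> omega
  · -- Cut both words at the first place past the longer of the two present prefixes.
    push Not at hnil
    have hσ' := one_le_expo hp hnil.1
    have hτ' := one_le_expo hp hnil.2
    obtain ⟨r, hr⟩ : ∃ r, r = min (expo p σ') (expo p τ') := ⟨_, rfl⟩
    obtain ⟨β, σ'', rfl, hβ⟩ := exists_prefix_mem_cut (p := p) (t := expo p σ' - r + 1)
      (by omega) σ' (by omega)
    obtain ⟨α, τ'', rfl, hα⟩ := exists_prefix_mem_cut (p := p) (t := expo p τ' - r + 1)
      (by omega) τ' (by omega)
    have hβ1 := hβ.2.1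
    have hβ2 := expo_lt_of_mem_cut hβ
    have hα1 := hα.2.1
    have hα2 := expo_lt_of_mem_cut hα
    simp only [expo_append] at *
    have heq : word lam p b (σ ++ β ++ σ'') = word lam p b (τ ++ α ++ τ'') := by simpa using h
    have hne : σ ++ β ≠ [] := by simp [hσ]
    have k1 : expo p (σ ++ β) + 1 ≤ expo p (τ ++ α) + maxExp p := by
      simp only [expo_append]; omega
    have k2 : expo p (τ ++ α) + 1 ≤ expo p (σ ++ β) + maxExp p := by
      simp only [expo_append]; omega
    have hmem := mem_vertexSet_of_word_eq h0 h1 hp hne k1 k2 heq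
    obtain ⟨y, hy, hpath⟩ := ih _ (by omega) _ _ _ _ hne k1 k2 heq ⟨_, hmem⟩ rfl rfl
    exact ⟨y, hy, .head (hedge α β _ (by omega) (by omega) (by omega) (by omega) rfl) hpath⟩

theorem hasExactOverlap_iff_exists_path (h0 : 0 < lam) (h1 : lam < 1) (hp : ∀ i, 1 ≤ p i) :
    HasExactOverlap lam p b ↔ ∃ u v : vertexSet lam p b,
      (u : ℤ × ℝ) ∈ startSet lam p b ∧ (v : ℤ × ℝ) = (0, 0) ∧
        Relation.ReflTransGen (graph lam p b).Adj u v := by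
  constructor
  · rintro ⟨i, j, hij, σ, τ, h⟩
    have hi := hp i
    have hj := hp j
    have hiT := le_maxExp (p := p) i
    have hjT := le_maxExp (p := p) j
    have k1 : expo p [i] + 1 ≤ expo p [j] + maxExp p := by simp; omega
    have k2 : expo p [j] + 1 ≤ expo p [i] + maxExp p := by simp; omega
    have hmem := mem_vertexSet_of_word_eq h0 h1 hp (σ := [i]) (τ := [j]) (by simp) k1 k2 h
    obtain ⟨y, hy, hpath⟩ := exists_path_of_word_eq h0 h1 hp i [i] [j] σ τ (by simp) k1 k2 h
      ⟨_, hmem⟩ rfl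
    refine ⟨⟨_, hmem⟩, y, ⟨hmem, i, j, hij, ?_⟩, hy, hpath⟩
    simp only [word_singleton]
  · rintro ⟨u, v, ⟨-, i, j, hij, hu⟩, hv, hpath⟩
    obtain ⟨σ', τ', h⟩ := exists_word_eq_of_path h0.ne' hpath hv [i] [j] (by
      rw [hu, word_singleton, word_singleton])
    exact ⟨i, j, hij, σ', τ', h⟩

end Graph

/-! ### The open set -/

section OpenSet

variable {m : ℕ} {lam : ℝ} {p : Fin m → ℕ} {b : Fin m → ℚ}

/-- The neighbours of the word `σ` with respect to `J`: the words `τ` of about the same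
contraction ratio, taken from one antichain of cut words, for which `S_σ(J)` and `S_τ(J)` meet. -/
def neighbors (lam : ℝ) (p : Fin m → ℕ) (b : Fin m → ℚ) (J : Set ℝ) (σ : List (Fin m)) :
    Set (List (Fin m)) :=
  {τ | τ ∈ cut p (expo p σ) ∧
    (act lam (word lam p b σ) '' J ∩ act lam (word lam p b τ) '' J).Nonempty}

/-- The relative positions `S_σ⁻¹ S_τ` of neighbours form one finite set, and without exact
overlaps `τ` is determined by `σ` and the relative position. -/
theorem exists_ncard_neighbors_le (hlam : IsPV lam⁻¹) (hp : ∀ i, 1 ≤ p i)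
    (hov : ¬ HasExactOverlap lam p b) (M : ℝ) :
    ∃ k : ℕ, ∀ σ : List (Fin m), σ ≠ [] →
      (neighbors lam p b (Set.Ioo (-M) M) σ).Finite ∧
        (neighbors lam p b (Set.Ioo (-M) M) σ).ncard ≤ k := by
  obtain ⟨h0, h1⟩ := hlam.pos_lt_one
  set F : Set (ℤ × ℝ) := Set.Icc 0 (maxExp p : ℤ) ×ˢ
    {x : ℝ | |x| ≤ 2 * M ∧ ∃ R : ℚ[X], (∀ n, R.coeff n ∈ digits b - digits b) ∧
      lam ^ (-(maxExp p : ℤ) + 2) * x = Polynomial.aeval lam⁻¹ R}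
  have hF : F.Finite := (Set.finite_Icc _ _).prod (finite_coord_of_bound hlam p b _)
  refine ⟨F.ncard, fun σ hσ => ?_⟩
  have hinj : Set.InjOn (fun τ => mul lam (inv lam (word lam p b σ)) (word lam p b τ))
      (neighbors lam p b (Set.Ioo (-M) M) σ) := fun τ _ τ' _ h =>
    word_injective h0.ne' hp hov (mul_left_cancel' h0.ne' h)
  have hmaps : Set.MapsTo (fun τ => mul lam (inv lam (word lam p b σ)) (word lam p b τ))
      (neighbors lam p b (Set.Ioo (-M) M) σ) F := by
    rintro τ ⟨hcut, z, ⟨x, hx, rfl⟩, y, hy, hxy⟩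
    have k1 := hcut.2.1
    have k2 := expo_lt_of_mem_cut hcut
    refine ⟨?_, ?_, exists_quotient_snd_eq h0.ne' hp hσ (by omega)⟩
    · simp only [mul, inv, word_fst, Set.mem_Icc]
      omega
    · have e : (mul lam (inv lam (word lam p b σ)) (word lam p b τ)).2 =
          x - lam ^ (expo p τ - expo p σ) * y := by
        have e3 : lam ^ (expo p τ - expo p σ) * lam ^ expo p σ = lam ^ expo p τ := by
          rw [← pow_add]; congr 1; omega
        simp only [act, mul, inv, word_fst, zpow_neg, zpow_natCast] at hxy ⊢
        have := (pow_pos h0 (expo p σ)).ne'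
        field_simp
        linear_combination hxy + y * e3
      have hpow : lam ^ (expo p τ - expo p σ) ≤ 1 := pow_le_one₀ h0.le h1.le
      have hpos := pow_pos h0 (expo p τ - expo p σ)
      have hx' : |x| ≤ M := abs_le.2 ⟨hx.1.le, hx.2.le⟩
      have hy' : |y| ≤ M := abs_le.2 ⟨hy.1.le, hy.2.le⟩
      rw [e]
      calc _ ≤ |x| + |lam ^ (expo p τ - expo p σ) * y| := abs_sub _ _
        _ ≤ M + 1 * M := by
          rw [abs_mul, abs_of_pos hpos]
          gcongr
        _ = _ := by ring
  exact ⟨Set.Finite.of_injOn hmaps hinj hF, Set.ncard_le_ncard_of_injOn _ hmaps hinj hF⟩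

theorem append_mem_neighbors (h0 : lam ≠ 0) {J : Set ℝ} {σ τ : List (Fin m)}
    (h : τ ∈ neighbors lam p b J σ) (ρ : List (Fin m)) :
    ρ ++ τ ∈ neighbors lam p b J (ρ ++ σ) := by
  obtain ⟨hcut, z, ⟨x, hx, rfl⟩, y, hy, hxy⟩ := h
  refine ⟨by simpa using append_mem_cut hcut ρ, _, ⟨x, hx, rfl⟩, y, hy, ?_⟩
  rw [word_append h0, word_append h0, act_mul h0, act_mul h0, hxy]

/-- For a word `ω` with the maximal number of neighbours, a word `ρ ++ ω` has no neighbours other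
than those forced by the neighbours of `ω`. -/
theorem exists_neighbors_append_eq (hlam : IsPV lam⁻¹) (hp : ∀ i, 1 ≤ p i) (c : Fin m)
    (hov : ¬ HasExactOverlap lam p b) (M : ℝ) :
    ∃ ω : List (Fin m), ω ≠ [] ∧ ∀ ρ, neighbors lam p b (Set.Ioo (-M) M) (ρ ++ ω) =
      (ρ ++ ·) '' neighbors lam p b (Set.Ioo (-M) M) ω := by
  obtain ⟨k, hk⟩ := exists_ncard_neighbors_le hlam hp hov M
  set A : Set ℕ := {n | ∃ σ : List (Fin m), σ ≠ [] ∧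
    (neighbors lam p b (Set.Ioo (-M) M) σ).ncard = n}
  have hbdd : BddAbove A := ⟨k, by rintro n ⟨σ, hσ, rfl⟩; exact (hk σ hσ).2⟩
  obtain ⟨ω, hω, hmax⟩ : sSup A ∈ A := Nat.sSup_mem ⟨_, [c], by simp, rfl⟩ hbdd
  refine ⟨ω, hω, fun ρ => ?_⟩
  have hne : ρ ++ ω ≠ [] := by simp [hω]
  symm
  refine Set.eq_of_subset_of_ncard_le ?_ ?_ (hk _ hne).1
  · rintro _ ⟨τ, hτ, rfl⟩
    exact append_mem_neighbors hlam.pos_lt_one.1.ne' hτ ρ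
  · rw [Set.ncard_image_of_injective _ (List.append_right_injective ρ), hmax]
    exact le_csSup hbdd ⟨_, hne, rfl⟩

theorem openSetCondition_of_not_hasExactOverlap (hlam : IsPV lam⁻¹) (hp : ∀ i, 1 ≤ p i)
    (c : Fin m) (hov : ¬ HasExactOverlap lam p b) : OpenSetCondition (ifs lam p b) := by
  obtain ⟨h0, h1⟩ := hlam.pos_lt_one
  have h2 : 0 < 1 - lam := by linarith
  set M : ℝ := maxAbs b / (1 - lam) + 1
  have hM0 : 0 < M := by have := maxAbs_nonneg (b := b); positivity
  have hM : lam * M + maxAbs b < M := by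
    have : M * (1 - lam) = maxAbs b + (1 - lam) := by simp only [M]; field_simp
    linarith
  have hJ : (⋃ i, ifs lam p b i '' Set.Ioo (-M) M) ⊆ Set.Ioo (-M) M := by
    refine Set.iUnion_subset fun i => ?_
    rintro _ ⟨x, hx, rfl⟩
    have h3 := abs_ifs_le (b := b) h0 h1 hp i x
    have h4 : |x| < M := abs_lt.2 hx
    have h5 := mul_lt_mul_of_pos_left h4 h0
    exact abs_lt.1 (by linarith)
  obtain ⟨ω, hω, hN⟩ := exists_neighbors_append_eq hlam hp c hov M
  set J := Set.Ioo (-M) M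
  -- A point of `S_{ρω}(J) ∩ S_{ρ'ω}(J)`, with `ρ ++ ω` the shorter word, makes a prefix of
  -- `ρ' ++ ω` a neighbour of `ρ ++ ω`, and this prefix begins with `ρ`.
  have key : ∀ ρ ρ' : List (Fin m), expo p ρ ≤ expo p ρ' →
      (act lam (word lam p b (ρ ++ ω)) '' J ∩ act lam (word lam p b (ρ' ++ ω)) '' J).Nonempty →
      ρ <+: ρ' ++ ω := by
    rintro ρ ρ' hle ⟨z, hz, x, hx, hxz⟩
    obtain ⟨τ, τ', hττ', hτ⟩ := exists_prefix_mem_cut (p := p) (t := expo p (ρ ++ ω))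
      (one_le_expo hp (by simp [hω])) (ρ' ++ ω) (by simpa using hle)
    have hmem : τ ∈ neighbors lam p b J (ρ ++ ω) := by
      refine ⟨hτ, z, hz, act lam (word lam p b τ') x, word_mapsTo h0.ne' hJ τ' hx, ?_⟩
      rw [← act_mul h0.ne', ← word_append h0.ne', hττ', hxz]
    rw [hN ρ] at hmem
    obtain ⟨τ₀, -, rfl⟩ := hmem
    exact ⟨τ₀ ++ τ', by rw [← hττ', List.append_assoc]⟩
  have key' : ∀ (i j : Fin m) (ρ ρ' : List (Fin m)),
      (act lam (word lam p b (i :: ρ ++ ω)) '' J ∩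
        act lam (word lam p b (j :: ρ' ++ ω)) '' J).Nonempty → i = j := by
    intro i j ρ ρ' h
    rcases le_total (expo p (i :: ρ)) (expo p (j :: ρ')) with hle | hle
    · exact (List.cons_prefix_cons.1 (key _ _ hle h)).1
    · rw [Set.inter_comm] at h
      exact (List.cons_prefix_cons.1 (key _ _ hle h)).1.symm
  have hstep : ∀ (i : Fin m) (ρ : List (Fin m)) (x : ℝ),
      ifs lam p b i (act lam (word lam p b (ρ ++ ω)) x) =
        act lam (word lam p b (i :: ρ ++ ω)) x := by
    intro i ρ x
    rw [List.cons_append, word, act_mul h0.ne', act_letter]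
  refine ⟨⋃ ρ : List (Fin m), act lam (word lam p b (ρ ++ ω)) '' J, ?_, ?_, ?_, ?_⟩
  · refine isOpen_iUnion fun ρ => ?_
    have hne : lam ^ (word lam p b (ρ ++ ω)).1 ≠ 0 := (zpow_pos h0 _).ne'
    exact ((Homeomorph.mulLeft₀ _ hne).trans (Homeomorph.addRight _)).isOpenMap _ isOpen_Ioo
  · exact ⟨_, Set.mem_iUnion.2 ⟨[], 0, ⟨by linarith, hM0⟩, rfl⟩⟩
  · refine Set.iUnion_subset fun i => ?_
    rintro _ ⟨y, hy, rfl⟩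
    obtain ⟨ρ, x, hx, rfl⟩ := Set.mem_iUnion.1 hy
    exact Set.mem_iUnion.2 ⟨i :: ρ, x, hx, (hstep i ρ x).symm⟩
  · intro i j hij
    rw [Set.eq_empty_iff_forall_notMem]
    rintro z ⟨⟨y, hy, rfl⟩, y', hy', hyy'⟩
    obtain ⟨ρ, x, hx, rfl⟩ := Set.mem_iUnion.1 hy
    obtain ⟨ρ', x', hx', rfl⟩ := Set.mem_iUnion.1 hy'
    rw [hstep, hstep] at hyy'
    exact hij (key' i j ρ ρ' ⟨_, ⟨x, hx, rfl⟩, x', hx', hyy'⟩)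

end OpenSet
end PVIFS
end

theorem theorem2 (lam : ℝ) (hlam : PVIFS.IsPV lam⁻¹) (m : ℕ) (hm : 1 ≤ m)
    (p : Fin m → ℕ) (hp : ∀ i, 1 ≤ p i) (b : Fin m → ℚ) :
    (PVIFS.vertexSet lam p b).Finite ∧
    (¬ PVIFS.OpenSetCondition (PVIFS.ifs lam p b) ↔
      ∃ u v : PVIFS.vertexSet lam p b,
        (u : ℤ × ℝ) ∈ PVIFS.startSet lam p b ∧ (v : ℤ × ℝ) = (0, 0) ∧
        Relation.ReflTransGen (PVIFS.graph lam p b).Adj u v) := by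
  obtain ⟨h0, h1⟩ := hlam.pos_lt_one
  refine ⟨PVIFS.finite_vertexSet hlam p b, ?_⟩
  rw [← PVIFS.hasExactOverlap_iff_exists_path h0 h1 hp]
  refine ⟨fun h => ?_, fun h => h.not_openSetCondition h0.ne'⟩
  by_contra hov
  exact h (PVIFS.openSetCondition_of_not_hasExactOverlap hlam hp ⟨0, hm⟩ hov)
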